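/- Let $l\ge 2$ and $0\le n<5$ be real numbers and, if $l>3$, suppose in addition that $n<\frac{l+2}{l-2}$. Consider the generalised Lane–Emden equation $$\frac{1}{\xi^{l-1}}\frac{d}{d\xi}\Bigl(\xi^{l-1}\frac{d\theta}{d\xi}\Bigr)+\theta^n=0,\qquad \theta(0)=1,\quad \theta'(0)=0 .$$ For $R>0$, a non-negative solution on $[0,R]$ is a differentiable function $\theta:[0,R]\to[0,\infty)$ with $\theta(0)=1$ and $\theta'(0)=0$ such that $\xi^{l-1}\theta'$ is differentiable on $(0,R]$ and the equation holds at every $\xi\in(0,R]$ (derivatives at end points are one-sided, and $\theta^0=1$). Then the solution has a zero at a finite point: there are $\xi_0\in(0,\infty)$ and a non-negative solution $\theta$ on $[0,\xi_0]$ with $\theta>0$ on $[0,\xi_0)$ and $\theta(\xi_0)=0$. Moreover, it is the only solution: every non-negative solution $\psi$ on an interval $[0,R]$, $R>0$, satisfies $R\le\xi_0$ and $\psi=\theta$ on $[0,R]$. -/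

import Mathlib

/-- `IsLaneEmdenSolution l n R θ`: on `[0, R]` the function `θ` is a non-negative classical
solution of the generalised Lane-Emden equation
`ξ ^ (1 - l) * (ξ ^ (l - 1) * θ')' + θ ^ n = 0` with `θ 0 = 1` and `θ' 0 = 0`.

Derivatives are taken within `[0, R]`, so they are one-sided at the two end points; the equation,
which is singular at the origin, is required on `(0, R]`.  Non-negativity is what gives `θ ^ n` a
meaning for real `n`. -/
structure IsLaneEmdenSolution (l n R : ℝ) (θ : ℝ → ℝ) : Prop where
  nonneg : ∀ ξ ∈ Set.Icc 0 R, 0 ≤ θ ξ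
  init : θ 0 = 1
  differentiableOn : DifferentiableOn ℝ θ (Set.Icc 0 R)
  init_deriv : derivWithin θ (Set.Icc 0 R) 0 = 0
  differentiableOn_flux : ∀ ξ ∈ Set.Ioc 0 R,
    DifferentiableWithinAt ℝ (fun s => s ^ (l - 1) * derivWithin θ (Set.Icc 0 R) s)
      (Set.Icc 0 R) ξ
  equation : ∀ ξ ∈ Set.Ioc 0 R,
    1 / ξ ^ (l - 1) *
        derivWithin (fun s => s ^ (l - 1) * derivWithin θ (Set.Icc 0 R) s) (Set.Icc 0 R) ξ
      + θ ξ ^ n = 0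

open Set Filter Topology

/-! Existence comes from the equivalent integral equation, whose kernel stays bounded at the
singular origin. The nonlinearity is truncated to a bounded continuous function and a compactness
argument is used, since for `0 < n < 1` the power is not Lipschitz at zero
(`exists_radial_solution`). The result solves the original equation as long as it is non-negative.

A zero is forced by a Pohozaev identity. Both restrictions on `n` reduce to subcriticality, `n * (l
- 2) < l + 2`, which makes the Pohozaev functional of a positive solution increasing, hence at least
a fixed positive constant beyond `1` (`le_pohozaev`). A positive solution also decays like a power
of the radius, and its derivative decays accordingly, so the functional is arbitrarily small far out
(`pohozaev_le`). The two bounds clash at a radius depending only on `l` and `n`.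

Uniqueness is an energy estimate where one solution is bounded away from zero, extended by
continuity to its first zero. There the slope is strictly negative, so no non-negative solution goes
further (`le_of_eq_zero`). -/

/-- The mean `t * ∫₀¹ w(σ) v(t σ) dσ`; for `w σ = σ ^ (l - 1)` it equals
`t ^ (1 - l) * ∫₀ᵗ s ^ (l - 1) v(s) ds`. -/
noncomputable def radialFlux (w v : ℝ → ℝ) (t : ℝ) : ℝ :=
  ∫ σ in (0 : ℝ)..1, t * (w σ * v (t * σ))

/-- The primitive of `radialFlux` vanishing at the origin. -/
noncomputable def radialPotential (w v : ℝ → ℝ) (ξ : ℝ) : ℝ :=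
  ∫ t in (0 : ℝ)..ξ, radialFlux w v t

/-! ### The radial integral operator and Peano existence. -/

section RadialIntegral

variable {w v v₁ v₂ : ℝ → ℝ} {T : ℝ}

theorem continuous_radialFlux (hw : Continuous w) (hv : Continuous v) :
    Continuous (radialFlux w v) := by
  unfold radialFlux
  apply intervalIntegral.continuous_parametric_intervalIntegral_of_continuous'
  fun_prop

theorem hasDerivAt_radialPotential (hw : Continuous w) (hv : Continuous v) (ξ : ℝ) :
    HasDerivAt (radialPotential w v) (radialFlux w v ξ) ξ :=
  intervalIntegral.integral_hasDerivAt_right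
    ((continuous_radialFlux hw hv).intervalIntegrable _ _)
    ((continuous_radialFlux hw hv).stronglyMeasurableAtFilter _ _)
    (continuous_radialFlux hw hv).continuousAt

theorem continuous_radialPotential (hw : Continuous w) (hv : Continuous v) :
    Continuous (radialPotential w v) :=
  continuous_iff_continuousAt.2 fun ξ => (hasDerivAt_radialPotential hw hv ξ).continuousAt

theorem radialFlux_congr {t : ℝ} (ht : 0 ≤ t) (h : EqOn v₁ v₂ (Icc 0 t)) :
    radialFlux w v₁ t = radialFlux w v₂ t := by
  refine intervalIntegral.integral_congr fun σ hσ => ?_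
  rw [uIcc_of_le zero_le_one] at hσ
  have : v₁ (t * σ) = v₂ (t * σ) :=
    h ⟨mul_nonneg ht hσ.1, mul_le_of_le_one_right ht hσ.2⟩
  simp only [this]

theorem radialPotential_congr {ξ : ℝ} (hξ : 0 ≤ ξ) (h : EqOn v₁ v₂ (Icc 0 ξ)) :
    radialPotential w v₁ ξ = radialPotential w v₂ ξ := by
  refine intervalIntegral.integral_congr fun t ht => ?_
  rw [uIcc_of_le hξ] at ht
  exact radialFlux_congr ht.1 (h.mono (Icc_subset_Icc_right ht.2))

theorem abs_radialFlux_le {t : ℝ} (ht : 0 ≤ t) (hw1 : ∀ σ ∈ Icc (0 : ℝ) 1, |w σ| ≤ 1)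
    (hv1 : ∀ s, |v s| ≤ 1) : |radialFlux w v t| ≤ t := by
  have := intervalIntegral.norm_integral_le_of_norm_le_const (a := (0 : ℝ)) (b := 1) (C := t)
    (f := fun σ => t * (w σ * v (t * σ))) fun σ hσ => ?_
  · simpa [radialFlux] using this
  · rw [uIoc_of_le zero_le_one] at hσ
    rw [Real.norm_eq_abs, abs_mul, abs_mul, abs_of_nonneg ht]
    exact mul_le_of_le_one_right ht
      (mul_le_one₀ (hw1 σ ⟨hσ.1.le, hσ.2⟩) (abs_nonneg _) (hv1 _))

theorem radialFlux_nonneg {t : ℝ} (ht : 0 ≤ t) (hw0 : ∀ σ ∈ Icc (0 : ℝ) 1, 0 ≤ w σ)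
    (hv0 : ∀ s, 0 ≤ v s) : 0 ≤ radialFlux w v t :=
  intervalIntegral.integral_nonneg zero_le_one fun σ hσ =>
    mul_nonneg ht (mul_nonneg (hw0 σ hσ) (hv0 _))

theorem radialPotential_nonneg {ξ : ℝ} (hξ : 0 ≤ ξ) (hw0 : ∀ σ ∈ Icc (0 : ℝ) 1, 0 ≤ w σ)
    (hv0 : ∀ s, 0 ≤ v s) : 0 ≤ radialPotential w v ξ :=
  intervalIntegral.integral_nonneg hξ fun _ ht => radialFlux_nonneg ht.1 hw0 hv0

theorem lipschitzOnWith_radialPotential (hT : 0 ≤ T) (hw : Continuous w) (hv : Continuous v)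
    (hw1 : ∀ σ ∈ Icc (0 : ℝ) 1, |w σ| ≤ 1) (hv1 : ∀ s, |v s| ≤ 1) :
    LipschitzOnWith T.toNNReal (radialPotential w v) (Icc 0 T) := by
  refine (convex_Icc 0 T).lipschitzOnWith_of_nnnorm_hasDerivWithin_le
    (fun ξ _ => (hasDerivAt_radialPotential hw hv ξ).hasDerivWithinAt) fun ξ hξ => ?_
  rw [← NNReal.coe_le_coe, Real.coe_toNNReal _ hT, coe_nnnorm, Real.norm_eq_abs]
  exact (abs_radialFlux_le hξ.1 hw1 hv1).trans hξ.2

theorem tendsto_radialPotential {V : ℕ → ℝ → ℝ} {ξ : ℝ} (hξ : 0 ≤ ξ) (hw : Continuous w)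
    (hV : ∀ k, Continuous (V k))
    (hw1 : ∀ σ ∈ Icc (0 : ℝ) 1, |w σ| ≤ 1) (hV1 : ∀ k s, |V k s| ≤ 1)
    (hlim : ∀ s ∈ Icc 0 ξ, Tendsto (fun k => V k s) atTop (𝓝 (v s))) :
    Tendsto (fun k => radialPotential w (V k) ξ) atTop (𝓝 (radialPotential w v ξ)) := by
  refine intervalIntegral.tendsto_integral_filter_of_dominated_convergence (fun t => t)
    (Eventually.of_forall fun k => (continuous_radialFlux hw (hV k)).aestronglyMeasurable)
    (Eventually.of_forall fun k => Eventually.of_forall fun t ht => ?_)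
    (continuous_id.intervalIntegrable _ _) (Eventually.of_forall fun t ht => ?_)
  · rw [uIoc_of_le hξ] at ht
    exact abs_radialFlux_le ht.1.le hw1 (hV1 k)
  rw [uIoc_of_le hξ] at ht
  refine intervalIntegral.tendsto_integral_filter_of_dominated_convergence (fun _ => t)
    (Eventually.of_forall fun k => Continuous.aestronglyMeasurable ?_)
    (Eventually.of_forall fun k => Eventually.of_forall fun σ hσ => ?_)
    (continuous_const.intervalIntegrable _ _) (Eventually.of_forall fun σ hσ => ?_)
  · have := hV k
    fun_prop
  · rw [uIoc_of_le zero_le_one] at hσ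
    rw [Real.norm_eq_abs, abs_mul, abs_mul, abs_of_pos ht.1]
    exact mul_le_of_le_one_right ht.1.le
      (mul_le_one₀ (hw1 σ ⟨hσ.1.le, hσ.2⟩) (abs_nonneg _) (hV1 _ _))
  · rw [uIoc_of_le zero_le_one] at hσ
    refine ((hlim _ ⟨mul_nonneg ht.1.le hσ.1.le, ?_⟩).const_mul _).const_mul _
    exact (mul_le_of_le_one_right ht.1.le hσ.2).trans ht.2

/-- The delayed integral equation is solved by iteration, one delay length at a time. -/
theorem exists_delayed_solution {g : ℝ → ℝ} (hg : Continuous g) (hw : Continuous w) {δ : ℝ}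
    (hδ : 0 < δ) (T : ℝ) :
    ∃ u : ℝ → ℝ, Continuous u ∧
      ∀ ξ ∈ Icc 0 T, u ξ = 1 - radialPotential w (fun s => g (u (max (s - δ) 0))) ξ := by
  have step : ∀ m : ℕ, ∃ u : ℝ → ℝ, Continuous u ∧ ∀ ξ ∈ Icc 0 (m * δ),
      u ξ = 1 - radialPotential w (fun s => g (u (max (s - δ) 0))) ξ := by
    intro m
    induction m with
    | zero =>
      refine ⟨fun _ => 1, continuous_const, fun ξ hξ => ?_⟩
      have : ξ = 0 := le_antisymm (by simpa using hξ.2) hξ.1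
      simp [this, radialPotential]
    | succ m ih =>
      obtain ⟨u, hu, h⟩ := ih
      have hc : Continuous fun s => g (u (max (s - δ) 0)) := by fun_prop
      refine ⟨fun ξ => 1 - radialPotential w (fun s => g (u (max (s - δ) 0))) ξ,
        continuous_const.sub (continuous_radialPotential hw hc), fun ξ hξ => ?_⟩
      -- Up to `(m + 1) * δ` the delayed argument stays in `[0, m * δ]`, where the old iterate
      -- satisfies the equation and so equals the new one.
      refine congrArg (1 - ·) (radialPotential_congr hξ.1 fun s hs => ?_)
      simp only
      rw [← h]
      have h1 := hs.2.trans hξ.2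
      push_cast at h1
      exact ⟨le_max_right _ _, max_le (by linarith) (by positivity)⟩
  obtain ⟨m, hm⟩ := exists_nat_ge (T / δ)
  obtain ⟨u, hu, h⟩ := step m
  rw [div_le_iff₀ hδ] at hm
  exact ⟨u, hu, fun ξ hξ => h ξ ⟨hξ.1, hξ.2.trans hm⟩⟩

/-- Peano existence for the singular integral equation. -/
theorem exists_radial_solution {g : ℝ → ℝ} (hg : Continuous g) (hg1 : ∀ x, |g x| ≤ 1)
    (hw : Continuous w) (hw1 : ∀ σ ∈ Icc (0 : ℝ) 1, |w σ| ≤ 1) (hT : 0 ≤ T) :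
    ∃ u : ℝ → ℝ, Continuous u ∧
      ∀ ξ ∈ Icc 0 T, u ξ = 1 - radialPotential w (fun s => g (u s)) ξ := by
  have hδ : ∀ k : ℕ, (0 : ℝ) < 1 / (k + 1) := fun k => by positivity
  choose u hu hsol using fun k => exists_delayed_solution hg hw (hδ k) T
  have hdc : ∀ k : ℕ, Continuous fun s => g (u k (max (s - 1 / (k + 1)) 0)) := fun k => by
    have := hu k
    fun_prop
  have hlip : ∀ k, LipschitzOnWith T.toNNReal (u k) (Icc 0 T) := by
    intro k x hx y hy
    rw [hsol k x hx, hsol k y hy, edist_sub_left]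
    exact lipschitzOnWith_radialPotential hT hw (hdc k) hw1 (fun s => hg1 _) hx hy
  have h0 : (0 : ℝ) ∈ Icc 0 T := ⟨le_rfl, hT⟩
  have hu0 : ∀ k, u k 0 = 1 := fun k => by simp [hsol k 0 h0, radialPotential]
  let U : ℕ → BoundedContinuousFunction (Icc 0 T) ℝ := fun k =>
    BoundedContinuousFunction.mkOfCompact ⟨fun x => u k x, (hu k).comp continuous_subtype_val⟩
  have hU : ∀ k x, U k x = u k x := fun _ _ => rfl
  have hcomp := BoundedContinuousFunction.arzela_ascoli (Icc (1 - T * T) (1 + T * T))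
    isCompact_Icc (range U) (by
      rintro _ x ⟨k, rfl⟩
      have h1 := (hlip k).dist_le_mul x x.2 0 h0
      rw [Real.dist_eq, Real.dist_eq, hu0, sub_zero, Real.coe_toNNReal _ hT,
        abs_of_nonneg x.2.1] at h1
      have h2 := abs_le.1 (h1.trans (mul_le_mul_of_nonneg_left x.2.2 hT))
      rw [hU]
      exact ⟨by linarith [h2.1], by linarith [h2.2]⟩) (by
      refine UniformEquicontinuous.equicontinuous
        (LipschitzWith.uniformEquicontinuous _ T.toNNReal ?_)
      rintro ⟨_, k, rfl⟩
      exact (hlip k).to_restrict)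
  obtain ⟨θ, -, φ, hφ, hlim⟩ :=
    hcomp.tendsto_subseq (x := U) fun k => subset_closure (mem_range_self k)
  have hpt : ∀ x (hx : x ∈ Icc 0 T), Tendsto (fun k => u (φ k) x) atTop (𝓝 (θ ⟨x, hx⟩)) :=
    fun x hx => ((continuous_eval_const (⟨x, hx⟩ : Icc 0 T)).tendsto θ).comp hlim
  refine ⟨IccExtend hT θ, θ.continuous.Icc_extend', fun ξ hξ => ?_⟩
  have hext : ∀ x (hx : x ∈ Icc 0 T), IccExtend hT θ x = θ ⟨x, hx⟩ :=
    fun x hx => IccExtend_of_mem hT θ hx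
  rw [hext ξ hξ]
  refine tendsto_nhds_unique (hpt ξ hξ) ?_
  simp_rw [fun k => hsol (φ k) ξ hξ]
  refine tendsto_const_nhds.sub (tendsto_radialPotential hξ.1 hw (fun k => hdc (φ k)) hw1
    (fun k s => hg1 _) fun s hs => (hg.tendsto _).comp ?_)
  have hs' : s ∈ Icc 0 T := ⟨hs.1, hs.2.trans hξ.2⟩
  rw [hext s hs']
  -- The delay disappears in the limit: the approximations share the Lipschitz constant `T`, so a
  -- shift by `1 / (φ k + 1)` costs at most `T` times that.
  have hd : Tendsto (fun k => T * (1 / ((φ k : ℝ) + 1))) atTop (𝓝 0) := by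
    simpa using (tendsto_one_div_add_atTop_nhds_zero_nat.comp hφ.tendsto_atTop).const_mul T
  refine (hpt s hs').congr_dist (squeeze_zero (fun _ => dist_nonneg) (fun k => ?_) hd)
  have hk := hδ (φ k)
  have hm : max (s - 1 / ((φ k : ℝ) + 1)) 0 ∈ Icc 0 T :=
    ⟨le_max_right _ _, max_le (by linarith [hs'.2]) hT⟩
  refine ((hlip (φ k)).dist_le_mul s hs' _ hm).trans ?_
  rw [Real.coe_toNNReal _ hT]
  refine mul_le_mul_of_nonneg_left ?_ hT
  rw [Real.dist_eq, abs_of_nonneg]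
  · linarith [le_max_left (s - 1 / ((φ k : ℝ) + 1)) 0]
  · exact sub_nonneg.2 (max_le (by linarith) hs.1)

end RadialIntegral

/-! ### Monotonicity and a priori bounds near the origin. -/

/-- If `f' 0 = 0` and `s ^ p * f' s` is antitone, then `f'` is non-positive. -/
theorem deriv_nonpos_of_antitoneOn_rpow_mul {f f' : ℝ → ℝ} {p r : ℝ} (hp : 0 ≤ p)
    (hf : ∀ s ∈ Icc 0 r, HasDerivWithinAt f (f' s) (Icc 0 r) s) (h0 : f' 0 = 0)
    (hanti : AntitoneOn (fun s => s ^ p * f' s) (Ioc 0 r)) {ξ : ℝ} (hξ : ξ ∈ Icc 0 r) :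
    f' ξ ≤ 0 := by
  rcases hξ.1.eq_or_lt with h | hpos
  · rw [← h, h0]
  by_contra! hc
  have hsub : Icc 0 ξ ⊆ Icc 0 r := Icc_subset_Icc_right hξ.2
  -- If `f' ξ > 0`, antitonicity gives `f' s ≥ f' ξ` on `(0, ξ)`. So `f s - f' ξ * s` is monotone,
  -- although its derivative at `0` is `-f' ξ < 0`. Continuity of `f'` at `0` is not needed.
  have hf2 : ∀ s ∈ Icc 0 ξ, HasDerivWithinAt (fun s => f s - f' ξ * s) (f' s - f' ξ) (Icc 0 ξ) s :=
    fun s hs => (((hf s (hsub hs)).mono hsub).sub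
      ((hasDerivWithinAt_id s _).const_mul (f' ξ))).congr_deriv (by simp)
  have hmono : MonotoneOn (fun s => f s - f' ξ * s) (Icc 0 ξ) := by
    refine monotoneOn_of_hasDerivWithinAt_nonneg (convex_Icc 0 ξ)
      (fun s hs => (hf2 s hs).continuousWithinAt)
      (fun s hs => (hf2 s (interior_subset hs)).mono interior_subset) fun s hs => ?_
    rw [interior_Icc] at hs
    have h1 : ξ ^ p * f' ξ ≤ s ^ p * f' s :=
      hanti ⟨hs.1, hs.2.le.trans hξ.2⟩ ⟨hpos, hξ.2⟩ hs.2.le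
    have h2 : s ^ p * f' ξ ≤ ξ ^ p * f' ξ :=
      mul_le_mul_of_nonneg_right (Real.rpow_le_rpow hs.1.le hs.2.le hp) hc.le
    have := le_of_mul_le_mul_left (h2.trans h1) (Real.rpow_pos_of_pos hs.1 p)
    linarith
  have h := hmono.derivWithin_nonneg (x := 0)
  rw [(hf2 0 ⟨le_rfl, hpos.le⟩).derivWithin (uniqueDiffOn_Icc hpos 0 ⟨le_rfl, hpos.le⟩), h0] at h
  linarith

theorem hasDerivAt_rpow_div {l ξ : ℝ} (hl : 2 ≤ l) (hξ : 0 < ξ) :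
    HasDerivAt (fun s : ℝ => s ^ l / l) (ξ ^ (l - 1)) ξ := by
  refine ((Real.hasDerivAt_rpow_const (p := l) (Or.inl hξ.ne')).div_const l).congr_deriv ?_
  rw [mul_div_assoc, mul_div_cancel₀]
  linarith

namespace IsLaneEmdenSolution

variable {l n R : ℝ} {θ : ℝ → ℝ}

theorem hasDerivWithinAt (h : IsLaneEmdenSolution l n R θ) {ξ : ℝ} (hξ : ξ ∈ Icc 0 R) :
    HasDerivWithinAt θ (derivWithin θ (Icc 0 R) ξ) (Icc 0 R) ξ :=
  (h.differentiableOn ξ hξ).hasDerivWithinAt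

theorem hasDerivAt (h : IsLaneEmdenSolution l n R θ) {ξ : ℝ} (hξ : ξ ∈ Ioo 0 R) :
    HasDerivAt θ (derivWithin θ (Icc 0 R) ξ) ξ :=
  (h.hasDerivWithinAt (Ioo_subset_Icc_self hξ)).hasDerivAt (Icc_mem_nhds hξ.1 hξ.2)

theorem continuousOn (h : IsLaneEmdenSolution l n R θ) : ContinuousOn θ (Icc 0 R) :=
  h.differentiableOn.continuousOn

theorem hasDerivWithinAt_flux (h : IsLaneEmdenSolution l n R θ) {ξ : ℝ} (hξ : ξ ∈ Ioc 0 R) :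
    HasDerivWithinAt (fun s => s ^ (l - 1) * derivWithin θ (Icc 0 R) s)
      (-(ξ ^ (l - 1) * θ ξ ^ n)) (Icc 0 R) ξ := by
  have h1 := (h.differentiableOn_flux ξ hξ).hasDerivWithinAt
  have h2 := h.equation ξ hξ
  have h3 := (Real.rpow_pos_of_pos hξ.1 (l - 1)).ne'
  field_simp at h2
  exact h1.congr_deriv (by linarith)

theorem hasDerivWithinAt_deriv (h : IsLaneEmdenSolution l n R θ) {ξ : ℝ} (hξ : ξ ∈ Ioc 0 R) :
    HasDerivWithinAt (derivWithin θ (Icc 0 R))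
      (-((l - 1) / ξ * derivWithin θ (Icc 0 R) ξ) - θ ξ ^ n) (Icc 0 R) ξ := by
  have h1 := ((Real.hasDerivAt_rpow_const (p := -(l - 1))
    (Or.inl hξ.1.ne')).hasDerivWithinAt (s := Icc 0 R)).mul (h.hasDerivWithinAt_flux hξ)
  have hinv : ∀ s : ℝ, 0 < s → s ^ (-(l - 1)) * s ^ (l - 1) = 1 := fun s hs => by
    rw [← Real.rpow_add hs, neg_add_cancel, Real.rpow_zero]
  have hinv' : ξ ^ (-(l - 1) - 1) * ξ ^ (l - 1) = 1 / ξ := by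
    rw [← Real.rpow_add hξ.1, one_div, ← Real.rpow_neg_one]
    congr 1
    ring
  have h2 : ∀ s : ℝ, 0 < s → derivWithin θ (Icc 0 R) s =
      s ^ (-(l - 1)) * (s ^ (l - 1) * derivWithin θ (Icc 0 R) s) := fun s hs => by
    rw [← mul_assoc, hinv s hs, one_mul]
  refine (h1.congr_of_eventuallyEq ?_ (h2 ξ hξ.1)).congr_deriv ?_
  · filter_upwards [nhdsWithin_le_nhds (lt_mem_nhds hξ.1)] with s hs using h2 s hs
  · linear_combination (-(l - 1) * derivWithin θ (Icc 0 R) ξ) * hinv' - θ ξ ^ n * hinv ξ hξ.1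

theorem antitoneOn_flux (h : IsLaneEmdenSolution l n R θ) :
    AntitoneOn (fun s => s ^ (l - 1) * derivWithin θ (Icc 0 R) s) (Ioc 0 R) := by
  refine antitoneOn_of_hasDerivWithinAt_nonpos (convex_Ioc 0 R)
    (fun s hs => (h.hasDerivWithinAt_flux hs).continuousWithinAt.mono Ioc_subset_Icc_self)
    (fun s hs => (h.hasDerivWithinAt_flux (interior_subset hs)).mono
      (interior_subset.trans Ioc_subset_Icc_self)) fun s hs => ?_
  have hs' := interior_subset hs
  exact neg_nonpos.2 (mul_nonneg (Real.rpow_nonneg hs'.1.le _)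
    (Real.rpow_nonneg (h.nonneg s ⟨hs'.1.le, hs'.2⟩) _))

theorem deriv_nonpos (h : IsLaneEmdenSolution l n R θ) (hl : 2 ≤ l) {ξ : ℝ}
    (hξ : ξ ∈ Icc 0 R) : derivWithin θ (Icc 0 R) ξ ≤ 0 :=
  deriv_nonpos_of_antitoneOn_rpow_mul (by linarith) (fun _ hs => h.hasDerivWithinAt hs)
    h.init_deriv h.antitoneOn_flux hξ

theorem antitoneOn (h : IsLaneEmdenSolution l n R θ) (hl : 2 ≤ l) : AntitoneOn θ (Icc 0 R) :=
  antitoneOn_of_hasDerivWithinAt_nonpos (convex_Icc 0 R) h.continuousOn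
    (fun _ hs => (h.hasDerivWithinAt (interior_subset hs)).mono interior_subset)
    fun _ hs => h.deriv_nonpos hl (interior_subset hs)

theorem le_one (h : IsLaneEmdenSolution l n R θ) (hl : 2 ≤ l) {ξ : ℝ} (hξ : ξ ∈ Icc 0 R) :
    θ ξ ≤ 1 :=
  (h.antitoneOn hl ⟨le_rfl, hξ.1.trans hξ.2⟩ hξ hξ.1).trans_eq h.init

/-- Comparison with `1 - s ^ 2 / (2 * l)`, the solution for `n = 0`: the source satisfies `θ ^ n ≤
1`. -/
theorem neg_div_le_deriv (h : IsLaneEmdenSolution l n R θ) (hl : 2 ≤ l) (hn : 0 ≤ n) {ξ : ℝ}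
    (hξ : ξ ∈ Icc 0 R) : -(ξ / l) ≤ derivWithin θ (Icc 0 R) ξ := by
  have hl0 : (0 : ℝ) < l := by linarith
  have key : -(derivWithin θ (Icc 0 R) ξ) - ξ / l ≤ 0 := by
    refine deriv_nonpos_of_antitoneOn_rpow_mul (p := l - 1) (r := R)
      (f := fun s => -θ s - s ^ 2 / (2 * l)) (f' := fun s => -(derivWithin θ (Icc 0 R) s) - s / l)
      (by linarith) (fun s hs => ?_) (by simp [h.init_deriv]) ?_ hξ
    · refine ((h.hasDerivWithinAt hs).neg.sub
        (((hasDerivAt_pow 2 s).div_const (2 * l)).hasDerivWithinAt)).congr_deriv ?_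
      field_simp
      push_cast
      ring
    · have h1 : AntitoneOn (fun s => -(s ^ (l - 1) * derivWithin θ (Icc 0 R) s) - s ^ l / l)
          (Ioc 0 R) := by
        have hd : ∀ s ∈ Ioc 0 R, HasDerivWithinAt
            (fun s => -(s ^ (l - 1) * derivWithin θ (Icc 0 R) s) - s ^ l / l)
            (- -(s ^ (l - 1) * θ s ^ n) - s ^ (l - 1)) (Icc 0 R) s := fun s hs =>
          (h.hasDerivWithinAt_flux hs).neg.sub (hasDerivAt_rpow_div hl hs.1).hasDerivWithinAt
        refine antitoneOn_of_hasDerivWithinAt_nonpos (convex_Ioc 0 R)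
          (fun s hs => (hd s hs).continuousWithinAt.mono Ioc_subset_Icc_self)
          (fun s hs => (hd s (interior_subset hs)).mono
            (interior_subset.trans Ioc_subset_Icc_self)) fun s hs => ?_
        have hs' := Ioc_subset_Icc_self (interior_subset hs)
        have h2 : θ s ^ n ≤ 1 := Real.rpow_le_one (h.nonneg s hs') (h.le_one hl hs') hn
        have h3 := mul_le_of_le_one_right (Real.rpow_nonneg hs'.1 (l - 1)) h2
        linarith
      refine h1.congr fun s hs => ?_
      have : s ^ l = s ^ (l - 1) * s := by
        rw [← Real.rpow_add_one hs.1.ne', sub_add_cancel]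
      simp only [this]
      ring
  linarith

/-- Only the origin needs an argument, as the equation is not imposed there: the derivative is
squeezed between `-(s / l)` and `0`. -/
theorem continuousOn_deriv (h : IsLaneEmdenSolution l n R θ) (hl : 2 ≤ l) (hn : 0 ≤ n) :
    ContinuousOn (derivWithin θ (Icc 0 R)) (Icc 0 R) := by
  intro ξ hξ
  rcases hξ.1.eq_or_lt with rfl | hpos
  · have hlim : Tendsto (fun s : ℝ => -(s / l)) (𝓝[Icc 0 R] 0) (𝓝 0) := by
      have : Continuous fun s : ℝ => -(s / l) := by fun_prop
      simpa using (this.tendsto 0).mono_left nhdsWithin_le_nhds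
    rw [ContinuousWithinAt, h.init_deriv]
    refine tendsto_of_tendsto_of_tendsto_of_le_of_le' hlim tendsto_const_nhds ?_ ?_
    · filter_upwards [self_mem_nhdsWithin] with s hs using h.neg_div_le_deriv hl hn hs
    · filter_upwards [self_mem_nhdsWithin] with s hs using h.deriv_nonpos hl hs
  · exact (h.hasDerivWithinAt_deriv ⟨hpos, hξ.2⟩).continuousWithinAt

theorem one_sub_le (h : IsLaneEmdenSolution l n R θ) (hl : 2 ≤ l) (hn : 0 ≤ n) {ξ : ℝ}
    (hξ : ξ ∈ Icc 0 R) : 1 - ξ ^ 2 / (2 * l) ≤ θ ξ := by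
  have hl0 : (0 : ℝ) < l := by linarith
  have hd : ∀ s ∈ Icc 0 R, HasDerivWithinAt (fun s => θ s + s ^ 2 / (2 * l))
      (derivWithin θ (Icc 0 R) s + s / l) (Icc 0 R) s := fun s hs => by
    refine ((h.hasDerivWithinAt hs).add
      (((hasDerivAt_pow 2 s).div_const (2 * l)).hasDerivWithinAt)).congr_deriv ?_
    field_simp
    push_cast
    ring
  have hmono : MonotoneOn (fun s => θ s + s ^ 2 / (2 * l)) (Icc 0 R) :=
    monotoneOn_of_hasDerivWithinAt_nonneg (convex_Icc 0 R)
      (fun s hs => (hd s hs).continuousWithinAt)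
      (fun s hs => (hd s (interior_subset hs)).mono interior_subset) fun s hs => by
        linarith [h.neg_div_le_deriv hl hn (interior_subset hs)]
  have := hmono ⟨le_rfl, hξ.1.trans hξ.2⟩ hξ hξ.1
  simp only [h.init] at this
  norm_num at this
  linarith

theorem restrict (h : IsLaneEmdenSolution l n R θ) {r : ℝ} (hr : 0 < r) (hrR : r ≤ R) :
    EqOn (derivWithin θ (Icc 0 r)) (derivWithin θ (Icc 0 R)) (Icc 0 r) ∧
      IsLaneEmdenSolution l n r θ := by
  have hsub : Icc 0 r ⊆ Icc 0 R := Icc_subset_Icc_right hrR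
  have heq : EqOn (derivWithin θ (Icc 0 r)) (derivWithin θ (Icc 0 R)) (Icc 0 r) := fun s hs =>
    ((h.hasDerivWithinAt (hsub hs)).mono hsub).derivWithin (uniqueDiffOn_Icc hr s hs)
  have hfl : ∀ ξ ∈ Ioc 0 r, HasDerivWithinAt
      (fun s => s ^ (l - 1) * derivWithin θ (Icc 0 r) s)
      (-(ξ ^ (l - 1) * θ ξ ^ n)) (Icc 0 r) ξ := fun ξ hξ => by
    refine ((h.hasDerivWithinAt_flux ⟨hξ.1, hξ.2.trans hrR⟩).mono hsub).congr (fun s hs => ?_) ?_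
    · rw [heq hs]
    · rw [heq (Ioc_subset_Icc_self hξ)]
  refine ⟨heq, fun ξ hξ => h.nonneg ξ (hsub hξ), h.init, h.differentiableOn.mono hsub, ?_,
    fun ξ hξ => (hfl ξ hξ).differentiableWithinAt, fun ξ hξ => ?_⟩
  · rw [heq ⟨le_rfl, hr.le⟩, h.init_deriv]
  · rw [(hfl ξ hξ).derivWithin (uniqueDiffOn_Icc hr ξ (Ioc_subset_Icc_self hξ))]
    have := (Real.rpow_pos_of_pos hξ.1 (l - 1)).ne'
    field_simp
    ring

end IsLaneEmdenSolution

/-! ### Subcriticality and decay of positive solutions. -/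

/-- For `2 < l ≤ 3` the bound `n < 5` suffices, because `5 * (l - 2) ≤ l + 2` exactly when `l ≤ 3`.
-/
theorem mul_sub_two_lt_of_subcritical {l n : ℝ} (hl : 2 ≤ l) (hn5 : n < 5)
    (hsub : 3 < l → n < (l + 2) / (l - 2)) : n * (l - 2) < l + 2 := by
  rcases lt_or_ge 3 l with h3 | h3
  · exact (lt_div_iff₀ (by linarith)).1 (hsub h3)
  · rcases hl.eq_or_lt with rfl | h2
    · norm_num
    · nlinarith [mul_lt_mul_of_pos_right hn5 (sub_pos.2 h2)]

/-- An exponent `m` for which the decay `θ ≤ C ξ ^ (-2 / (m - 1))` kills the Pohozaev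
functional at infinity. -/
theorem exists_decay_exponent {l n : ℝ} (hl : 2 ≤ l) (hn : 0 ≤ n)
    (hcrit : n * (l - 2) < l + 2) :
    ∃ m, 1 < m ∧ n ≤ m ∧ l - 2 - 2 * (2 / (m - 1)) < 0 ∧ l - (n + 1) * (2 / (m - 1)) < 0 := by
  have hl0 : (0 : ℝ) < l := by linarith
  rcases lt_or_ge 1 n with h | h
  · have h1 : 0 < n - 1 := by linarith
    refine ⟨n, h, le_rfl, ?_, ?_⟩
    · rw [sub_neg, ← mul_div_assoc, lt_div_iff₀ h1]
      linarith
    · rw [sub_neg, ← mul_div_assoc, lt_div_iff₀ h1]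
      linarith
  -- For `n ≤ 1` any `m` slightly above `1` gives fast enough decay; this one makes `2 / (m - 1) = 2
  -- * l`.
  · refine ⟨1 + 1 / l, by simpa using hl0, h.trans (by simpa using hl0.le), ?_, ?_⟩
    · rw [add_sub_cancel_left, div_div_eq_mul_div, div_one]
      linarith
    · rw [add_sub_cancel_left, div_div_eq_mul_div, div_one]
      nlinarith [mul_nonneg hn hl0.le]

namespace IsLaneEmdenSolution

variable {l n R : ℝ} {θ : ℝ → ℝ}

/-- As `θ` decreases, the source on `[0, ξ]` is at least its value at `ξ`; integrate the flux
against `s ^ (l - 1)`. -/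
theorem deriv_le_neg_rpow_mul (h : IsLaneEmdenSolution l n R θ) (hl : 2 ≤ l) (hn : 0 ≤ n)
    {ξ : ℝ} (hξ : ξ ∈ Icc 0 R) : derivWithin θ (Icc 0 R) ξ ≤ -(θ ξ ^ n * ξ / l) := by
  have hl0 : (0 : ℝ) < l := by linarith
  have hsub : Icc 0 ξ ⊆ Icc 0 R := Icc_subset_Icc_right hξ.2
  have key : derivWithin θ (Icc 0 R) ξ + θ ξ ^ n * ξ / l ≤ 0 := by
    refine deriv_nonpos_of_antitoneOn_rpow_mul (p := l - 1) (r := ξ)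
      (f := fun s => θ s + θ ξ ^ n * (s ^ 2 / (2 * l)))
      (f' := fun s => derivWithin θ (Icc 0 R) s + θ ξ ^ n * s / l)
      (by linarith) (fun s hs => ?_) (by simp [h.init_deriv]) ?_ ⟨hξ.1, le_rfl⟩
    · refine (((h.hasDerivWithinAt (hsub hs)).mono hsub).add
        ((((hasDerivAt_pow 2 s).div_const (2 * l)).const_mul
          (θ ξ ^ n)).hasDerivWithinAt)).congr_deriv ?_
      field_simp
      push_cast
      ring
    · have hd : ∀ s ∈ Ioc 0 ξ, HasDerivWithinAt
          (fun s => s ^ (l - 1) * derivWithin θ (Icc 0 R) s + θ ξ ^ n * (s ^ l / l))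
          (-(s ^ (l - 1) * θ s ^ n) + θ ξ ^ n * s ^ (l - 1)) (Icc 0 R) s := fun s hs =>
        (h.hasDerivWithinAt_flux ⟨hs.1, hs.2.trans hξ.2⟩).add
          ((hasDerivAt_rpow_div hl hs.1).const_mul _).hasDerivWithinAt
      have h1 : AntitoneOn
          (fun s => s ^ (l - 1) * derivWithin θ (Icc 0 R) s + θ ξ ^ n * (s ^ l / l))
          (Ioc 0 ξ) := by
        refine antitoneOn_of_hasDerivWithinAt_nonpos (convex_Ioc 0 ξ)
          (fun s hs => (hd s hs).continuousWithinAt.mono (Ioc_subset_Icc_self.trans hsub))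
          (fun s hs => (hd s (interior_subset hs)).mono
            (interior_subset.trans (Ioc_subset_Icc_self.trans hsub))) fun s hs => ?_
        have hs' := Ioc_subset_Icc_self (interior_subset hs)
        have h2 : θ ξ ^ n ≤ θ s ^ n :=
          Real.rpow_le_rpow (h.nonneg ξ hξ) (h.antitoneOn hl (hsub hs') hξ hs'.2) hn
        have h3 := mul_le_mul_of_nonneg_right h2 (Real.rpow_nonneg hs'.1 (l - 1))
        linarith
      refine h1.congr fun s hs => ?_
      have : s ^ l = s ^ (l - 1) * s := by
        rw [← Real.rpow_add_one hs.1.ne', sub_add_cancel]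
      simp only [this]
      ring
  linarith

/-- Since `θ ≤ 1`, `θ' ≤ -θ ^ n * s / l ≤ -θ ^ m * s / l`. Separating variables makes `θ ^ (1 - m)`
grow at least quadratically, which is the decay of `θ`. -/
theorem rpow_sub_one_mul_sq_le (h : IsLaneEmdenSolution l n R θ) (hl : 2 ≤ l) (hn : 0 ≤ n)
    (hpos : ∀ s ∈ Icc 0 R, 0 < θ s) {m : ℝ} (hm1 : 1 < m) (hnm : n ≤ m) {ξ : ℝ}
    (hξ : ξ ∈ Icc 0 R) : θ ξ ^ (m - 1) * ξ ^ 2 ≤ 2 * l / (m - 1) := by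
  have hl0 : (0 : ℝ) < l := by linarith
  have hm0 : 0 < m - 1 := by linarith
  have hd : ∀ s ∈ Icc 0 R, HasDerivWithinAt
      (fun s => θ s ^ (1 - m) - (m - 1) * (s ^ 2 / (2 * l)))
      (derivWithin θ (Icc 0 R) s * (1 - m) * θ s ^ (1 - m - 1) - (m - 1) * (s / l))
      (Icc 0 R) s := fun s hs => by
    refine (((h.hasDerivWithinAt hs).rpow_const (Or.inl (hpos s hs).ne')).sub
      ((((hasDerivAt_pow 2 s).div_const (2 * l)).const_mul
        (m - 1)).hasDerivWithinAt)).congr_deriv ?_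
    field_simp
    push_cast
    ring
  have hmono := monotoneOn_of_hasDerivWithinAt_nonneg (convex_Icc 0 R)
    (fun s hs => (hd s hs).continuousWithinAt)
    (fun s hs => (hd s (interior_subset hs)).mono interior_subset) fun s hs => by
      have hs' := interior_subset hs
      have hp := hpos s hs'
      have h1 := h.deriv_le_neg_rpow_mul hl hn hs'
      have h2 : θ s ^ m ≤ θ s ^ n :=
        Real.rpow_le_rpow_of_exponent_ge hp (h.le_one hl hs') hnm
      have h3 : θ s ^ m * θ s ^ (1 - m - 1) = 1 := by
        rw [← Real.rpow_add hp]
        norm_num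
      have h4 : 0 < θ s ^ (1 - m - 1) := Real.rpow_pos_of_pos hp _
      have h5 : θ s ^ m * (s / l) ≤ -derivWithin θ (Icc 0 R) s := by
        have := mul_le_mul_of_nonneg_right h2 (div_nonneg hs'.1 hl0.le)
        rw [mul_div_assoc] at h1
        linarith
      have h6 := mul_le_mul_of_nonneg_right (mul_le_mul_of_nonneg_right h5 h4.le) hm0.le
      have h7 : θ s ^ m * (s / l) * θ s ^ (1 - m - 1) * (m - 1) = (m - 1) * (s / l) := by
        linear_combination (s / l * (m - 1)) * h3
      linarith
  have h0 := hmono ⟨le_rfl, hξ.1.trans hξ.2⟩ hξ hξ.1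
  simp only [h.init, Real.one_rpow] at h0
  norm_num at h0
  have hp := hpos ξ hξ
  have h1 : θ ξ ^ (m - 1) * θ ξ ^ (1 - m) = 1 := by
    rw [← Real.rpow_add hp]
    norm_num
  have h2 : 0 < θ ξ ^ (m - 1) := Real.rpow_pos_of_pos hp _
  have h3 : θ ξ ^ (m - 1) * ((m - 1) * (ξ ^ 2 / (2 * l))) ≤ 1 :=
    (mul_le_mul_of_nonneg_left (by linarith) h2.le).trans_eq h1
  rw [le_div_iff₀ hm0]
  calc θ ξ ^ (m - 1) * ξ ^ 2 * (m - 1)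
      = θ ξ ^ (m - 1) * ((m - 1) * (ξ ^ 2 / (2 * l))) * (2 * l) := by field_simp
    _ ≤ 1 * (2 * l) := mul_le_mul_of_nonneg_right h3 (by linarith)
    _ = 2 * l := one_mul _

/-- The antitone flux keeps the slope on `[X, 2 * X]` at most `θ' X / 2 ^ (l - 1)`; too steep a
slope at `X` would make `θ (2 * X)` negative. -/
theorem neg_deriv_mul_le (h : IsLaneEmdenSolution l n R θ) (hl : 2 ≤ l) {X : ℝ}
    (hX : 0 < X) (hXR : 2 * X ≤ R) :
    -derivWithin θ (Icc 0 R) X * X ≤ 2 ^ (l - 1) * θ X := by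
  have hsub : Icc X (2 * X) ⊆ Icc 0 R := Icc_subset_Icc hX.le hXR
  have h2 : (0 : ℝ) < 2 ^ (l - 1) := Real.rpow_pos_of_pos two_pos _
  set κ := derivWithin θ (Icc 0 R) X / 2 ^ (l - 1) with hκ
  have hκ' : derivWithin θ (Icc 0 R) X = κ * 2 ^ (l - 1) := by rw [hκ]; field_simp
  have hd : ∀ s ∈ Icc X (2 * X), HasDerivWithinAt (fun s => θ s - κ * s)
      (derivWithin θ (Icc 0 R) s - κ) (Icc X (2 * X)) s := fun s hs =>
    (((h.hasDerivWithinAt (hsub hs)).mono hsub).sub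
      ((hasDerivWithinAt_id s _).const_mul κ)).congr_deriv (by simp)
  have hanti := antitoneOn_of_hasDerivWithinAt_nonpos (convex_Icc X (2 * X))
    (fun s hs => (hd s hs).continuousWithinAt)
    (fun s hs => (hd s (interior_subset hs)).mono interior_subset) fun s hs => by
      have hs' := interior_subset hs
      have h1 : s ^ (l - 1) * derivWithin θ (Icc 0 R) s ≤
          X ^ (l - 1) * derivWithin θ (Icc 0 R) X :=
        h.antitoneOn_flux ⟨hX, by linarith⟩ ⟨hX.trans_le hs'.1, hs'.2.trans hXR⟩ hs'.1
      have h3 : s ^ (l - 1) ≤ (2 * X) ^ (l - 1) :=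
        Real.rpow_le_rpow (hX.le.trans hs'.1) hs'.2 (by linarith)
      have h4 := mul_le_mul_of_nonpos_right h3 (h.deriv_nonpos hl (hsub hs'))
      have h5 : (0 : ℝ) < (2 * X) ^ (l - 1) := by positivity
      have h6 : (2 * X) ^ (l - 1) * κ = X ^ (l - 1) * derivWithin θ (Icc 0 R) X := by
        rw [Real.mul_rpow two_pos.le hX.le, hκ']
        ring
      exact sub_nonpos.2 (le_of_mul_le_mul_left (by linarith) h5)
  have h3 := hanti ⟨le_rfl, by linarith⟩ ⟨by linarith, le_rfl⟩ (by linarith : X ≤ 2 * X)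
  simp only at h3
  have h4 := h.nonneg (2 * X) ⟨by linarith, hXR⟩
  have h5 : -κ * X ≤ θ X := by linarith
  rw [hκ']
  nlinarith [mul_le_mul_of_nonneg_left h5 h2.le]

end IsLaneEmdenSolution

/-! ### The Pohozaev functional and the forced zero. -/

/-- The Pohozaev functional of the generalised Lane-Emden equation. -/
noncomputable def pohozaev (l n : ℝ) (θ y : ℝ → ℝ) (s : ℝ) : ℝ :=
  s ^ l * (y s ^ 2 / 2 + θ s ^ (n + 1) / (n + 1)) + (l - 2) / 2 * (s ^ (l - 1) * y s * θ s)

namespace IsLaneEmdenSolution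

variable {l n R : ℝ} {θ : ℝ → ℝ}

/-- The weight `(l - 2) / 2` is chosen so that the `θ' ^ 2` terms cancel: `l / 2 - (l - 1) + (l - 2)
/ 2 = 0`. -/
theorem hasDerivWithinAt_pohozaev (h : IsLaneEmdenSolution l n R θ) (hn : 0 ≤ n) {s : ℝ}
    (hs : s ∈ Ioc 0 R) (hpos : 0 < θ s) :
    HasDerivWithinAt (pohozaev l n θ (derivWithin θ (Icc 0 R)))
      ((l / (n + 1) - (l - 2) / 2) * (s ^ (l - 1) * θ s ^ (n + 1))) (Icc 0 R) s := by
  have hθ := h.hasDerivWithinAt (Ioc_subset_Icc_self hs)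
  have h1 := (Real.hasDerivAt_rpow_const (p := l) (Or.inl hs.1.ne')).hasDerivWithinAt
    (s := Icc 0 R)
  have h2 := ((h.hasDerivWithinAt_deriv hs).pow 2).div_const 2
  have h3 := (hθ.rpow_const (p := n + 1) (Or.inl hpos.ne')).div_const (n + 1)
  have h4 := ((h.hasDerivWithinAt_flux hs).mul hθ).const_mul ((l - 2) / 2)
  refine ((h1.mul (h2.add h3)).add h4).congr_deriv ?_
  have e1 : s ^ l = s ^ (l - 1) * s := by
    rw [← Real.rpow_add_one hs.1.ne', sub_add_cancel]
  have e2 : θ s ^ (n + 1) = θ s ^ n * θ s := Real.rpow_add_one hpos.ne' n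
  have hn1 : n + 1 ≠ 0 := by linarith
  have hs0 := hs.1.ne'
  simp only [Pi.add_apply, Pi.pow_apply, add_sub_cancel_right]
  rw [e1, e2]
  field_simp
  push_cast
  ring

/-- The functional vanishes at `0` and increases. On `[0, 1]` one has `θ ≥ 1 - 1 / (2 * l) ≥ 3 / 4`,
so the gain there is bounded below independently of `θ` and `R`. -/
theorem le_pohozaev (h : IsLaneEmdenSolution l n R θ) (hl : 2 ≤ l) (hn : 0 ≤ n)
    (hpos : ∀ s ∈ Icc 0 R, 0 < θ s) (hcrit : n * (l - 2) < l + 2) {X : ℝ} (hX : 1 ≤ X)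
    (hXR : X ≤ R) :
    (l / (n + 1) - (l - 2) / 2) * (3 / 4) ^ (n + 1) / l ≤
      pohozaev l n θ (derivWithin θ (Icc 0 R)) X := by
  have hl0 : (0 : ℝ) < l := by linarith
  set c := l / (n + 1) - (l - 2) / 2 with hc
  have hc0 : 0 < c := by
    rw [hc, sub_pos, div_lt_div_iff₀ two_pos (by linarith)]
    linarith
  have hcont : ContinuousOn (pohozaev l n θ (derivWithin θ (Icc 0 R))) (Icc 0 R) := by
    have h1 := h.continuousOn_deriv hl hn
    have h2 := h.continuousOn.rpow_const fun s _ => Or.inr (by linarith : 0 ≤ n + 1)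
    have h3 : Continuous fun s : ℝ => s ^ l := Real.continuous_rpow_const hl0.le
    have h4 : Continuous fun s : ℝ => s ^ (l - 1) := Real.continuous_rpow_const (by linarith)
    exact (h3.continuousOn.mul (((h1.pow 2).div_const 2).add (h2.div_const _))).add
      (((h4.continuousOn.mul h1).mul h.continuousOn).const_mul _)
  have hd : ∀ s ∈ Ioo 0 R, HasDerivAt (pohozaev l n θ (derivWithin θ (Icc 0 R)))
      (c * (s ^ (l - 1) * θ s ^ (n + 1))) s := fun s hs =>
    (h.hasDerivWithinAt_pohozaev hn (Ioo_subset_Ioc_self hs)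
      (hpos s (Ioo_subset_Icc_self hs))).hasDerivAt (Icc_mem_nhds hs.1 hs.2)
  have hmono : MonotoneOn (pohozaev l n θ (derivWithin θ (Icc 0 R))) (Icc 0 R) := by
    refine monotoneOn_of_hasDerivWithinAt_nonneg (convex_Icc 0 R) hcont
      (fun s hs => (hd s (by rwa [interior_Icc] at hs)).hasDerivWithinAt) fun s hs => ?_
    have hs' := interior_subset hs
    exact mul_nonneg hc0.le (mul_nonneg (Real.rpow_nonneg hs'.1 _)
      (Real.rpow_nonneg (hpos s hs').le _))
  have h1R : 1 ≤ R := hX.trans hXR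
  have hsub : Icc (0 : ℝ) 1 ⊆ Icc 0 R := Icc_subset_Icc_right h1R
  have hmono1 : MonotoneOn (fun s => pohozaev l n θ (derivWithin θ (Icc 0 R)) s -
      c * (3 / 4) ^ (n + 1) * (s ^ l / l)) (Icc 0 1) := by
    refine monotoneOn_of_hasDerivWithinAt_nonneg (convex_Icc 0 1)
      (f' := fun s => c * (s ^ (l - 1) * θ s ^ (n + 1)) - c * (3 / 4) ^ (n + 1) * s ^ (l - 1))
      ((hcont.mono hsub).sub (Continuous.continuousOn ?_)) (fun s hs => ?_) fun s hs => ?_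
    · have : Continuous fun s : ℝ => s ^ l := Real.continuous_rpow_const hl0.le
      fun_prop
    · rw [interior_Icc] at hs
      exact ((hd s ⟨hs.1, hs.2.trans_le h1R⟩).sub
        ((hasDerivAt_rpow_div hl hs.1).const_mul _)).hasDerivWithinAt
    · have hs' := interior_subset hs
      have h1 : 3 / 4 ≤ θ s := by
        refine le_trans ?_ (h.one_sub_le hl hn (hsub hs'))
        have : s ^ 2 / (2 * l) ≤ 1 / 4 := by
          rw [div_le_div_iff₀ (by linarith) (by norm_num)]
          nlinarith [hs'.1, hs'.2]
        linarith
      have h2 : (3 / 4 : ℝ) ^ (n + 1) ≤ θ s ^ (n + 1) :=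
        Real.rpow_le_rpow (by norm_num) h1 (by linarith)
      have h3 := mul_le_mul_of_nonneg_left h2
        (mul_nonneg hc0.le (Real.rpow_nonneg hs'.1 (l - 1)))
      linarith
  have h1 := hmono1 ⟨le_rfl, zero_le_one⟩ ⟨zero_le_one, le_rfl⟩ zero_le_one
  have h2 := hmono ⟨zero_le_one, h1R⟩ ⟨zero_le_one.trans hX, hXR⟩ hX
  have h0 : pohozaev l n θ (derivWithin θ (Icc 0 R)) 0 = 0 := by
    simp [pohozaev, Real.zero_rpow hl0.ne', h.init_deriv]
  simp only [h0, Real.zero_rpow hl0.ne', Real.one_rpow, zero_div, mul_zero] at h1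
  have h3 : c * (3 / 4) ^ (n + 1) / l = c * (3 / 4) ^ (n + 1) * (1 / l) := by ring
  rw [h3]
  linarith

theorem pohozaev_le (h : IsLaneEmdenSolution l n R θ) (hl : 2 ≤ l) (hn : 0 ≤ n)
    (hpos : ∀ s ∈ Icc 0 R, 0 < θ s) {m : ℝ} (hm1 : 1 < m) (hnm : n ≤ m) {X : ℝ}
    (hX : 0 < X) (hXR : 2 * X ≤ R) :
    pohozaev l n θ (derivWithin θ (Icc 0 R)) X ≤
      (2 ^ (l - 1)) ^ 2 / 2 * ((2 * l / (m - 1)) ^ (1 / (m - 1))) ^ 2 *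
          X ^ (l - 2 - 2 * (2 / (m - 1))) +
        ((2 * l / (m - 1)) ^ (1 / (m - 1))) ^ (n + 1) / (n + 1) *
          X ^ (l - (n + 1) * (2 / (m - 1))) := by
  have hl0 : (0 : ℝ) < l := by linarith
  have hm0 : 0 < m - 1 := by linarith
  have hXm : X ∈ Icc 0 R := ⟨hX.le, by linarith⟩
  have hp := hpos X hXm
  set α := 2 / (m - 1) with hα
  set C := (2 * l / (m - 1)) ^ (1 / (m - 1)) with hC
  have hD : 0 < 2 * l / (m - 1) := by positivity
  have hC0 : 0 < C := Real.rpow_pos_of_pos hD _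
  have hθ : θ X ≤ C * X ^ (-α) := by
    have h1 := h.rpow_sub_one_mul_sq_le hl hn hpos hm1 hnm hXm
    have h2 : θ X ^ (m - 1) ≤ 2 * l / (m - 1) * X ^ (-2 : ℝ) := by
      rw [Real.rpow_neg hX.le, Real.rpow_two, ← div_eq_mul_inv, le_div_iff₀ (by positivity)]
      exact h1
    have h3 := Real.rpow_le_rpow (Real.rpow_nonneg hp.le _) h2 (one_div_pos.2 hm0).le
    rw [← Real.rpow_mul hp.le, mul_one_div_cancel hm0.ne', Real.rpow_one,
      Real.mul_rpow hD.le (Real.rpow_nonneg hX.le _), ← Real.rpow_mul hX.le] at h3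
    convert h3 using 3
    rw [hα]
    ring
  have hXα : 0 < X ^ (-α) := Real.rpow_pos_of_pos hX _
  have hy : derivWithin θ (Icc 0 R) X ≤ 0 := h.deriv_nonpos hl hXm
  have hsq : (-derivWithin θ (Icc 0 R) X * X) ^ 2 ≤ (2 ^ (l - 1) * (C * X ^ (-α))) ^ 2 := by
    refine pow_le_pow_left₀ (mul_nonneg (neg_nonneg.2 hy) hX.le) ?_ 2
    exact (h.neg_deriv_mul_le hl hX hXR).trans
      (mul_le_mul_of_nonneg_left hθ (Real.rpow_nonneg two_pos.le _))
  have hpow : θ X ^ (n + 1) ≤ C ^ (n + 1) * X ^ (-α * (n + 1)) := by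
    rw [Real.rpow_mul hX.le, ← Real.mul_rpow hC0.le hXα.le]
    exact Real.rpow_le_rpow hp.le hθ (by linarith)
  have e1 : X ^ l = X ^ (l - 2) * X ^ 2 := by
    rw [← Real.rpow_two, ← Real.rpow_add hX, sub_add_cancel]
  have e2 : X ^ (l - 2 - 2 * α) = X ^ (l - 2) * (X ^ (-α)) ^ 2 := by
    rw [← Real.rpow_two, ← Real.rpow_mul hX.le, ← Real.rpow_add hX]
    congr 1
    ring
  have e3 : X ^ (l - (n + 1) * α) = X ^ l * X ^ (-α * (n + 1)) := by
    rw [← Real.rpow_add hX]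
    congr 1
    ring
  have t1 : X ^ l * (derivWithin θ (Icc 0 R) X ^ 2 / 2) ≤
      (2 ^ (l - 1)) ^ 2 / 2 * C ^ 2 * X ^ (l - 2 - 2 * α) := by
    rw [e1, e2]
    have := mul_le_mul_of_nonneg_left hsq (Real.rpow_nonneg hX.le (l - 2))
    nlinarith
  have t2 : X ^ l * (θ X ^ (n + 1) / (n + 1)) ≤
      C ^ (n + 1) / (n + 1) * X ^ (l - (n + 1) * α) := by
    rw [e3]
    have hn1 : 0 < n + 1 := by linarith
    calc X ^ l * (θ X ^ (n + 1) / (n + 1))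
        ≤ X ^ l * (C ^ (n + 1) * X ^ (-α * (n + 1)) / (n + 1)) := by gcongr
      _ = _ := by ring
  have t3 : (l - 2) / 2 * (X ^ (l - 1) * derivWithin θ (Icc 0 R) X * θ X) ≤ 0 :=
    mul_nonpos_of_nonneg_of_nonpos (by linarith) (mul_nonpos_of_nonpos_of_nonneg
      (mul_nonpos_of_nonneg_of_nonpos (Real.rpow_nonneg hX.le _) hy) hp.le)
  rw [pohozaev, mul_add]
  linarith

end IsLaneEmdenSolution

/-- A priori bound: positive solutions of the subcritical equation live on bounded intervals. -/
theorem exists_bound_of_positive_solution {l n : ℝ} (hl : 2 ≤ l) (hn : 0 ≤ n)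
    (hcrit : n * (l - 2) < l + 2) :
    ∃ T > 0, ∀ θ : ℝ → ℝ, IsLaneEmdenSolution l n T θ → ∃ s ∈ Icc 0 T, θ s ≤ 0 := by
  obtain ⟨m, hm1, hnm, h1, h2⟩ := exists_decay_exponent hl hn hcrit
  have hlim : ∀ (A : ℝ) {p : ℝ}, p < 0 → Tendsto (fun X : ℝ => A * X ^ p) atTop (𝓝 0) :=
    fun A p hp => by
      simpa using (tendsto_rpow_neg_atTop (neg_pos.2 hp)).const_mul A
  have hlim2 := (hlim ((2 ^ (l - 1)) ^ 2 / 2 * ((2 * l / (m - 1)) ^ (1 / (m - 1))) ^ 2) h1).add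
    (hlim (((2 * l / (m - 1)) ^ (1 / (m - 1))) ^ (n + 1) / (n + 1)) h2)
  rw [add_zero] at hlim2
  have hp : 0 < (l / (n + 1) - (l - 2) / 2) * (3 / 4) ^ (n + 1) / l := by
    have : 0 < l / (n + 1) - (l - 2) / 2 := by
      rw [sub_pos, div_lt_div_iff₀ two_pos (by linarith)]
      linarith
    have hl0 : 0 < l := by linarith
    positivity
  obtain ⟨X, hX1, hX⟩ := ((eventually_ge_atTop (1 : ℝ)).and (hlim2.eventually_lt_const hp)).exists
  -- The derivative bound at `X` needs the solution up to `2 * X`.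
  refine ⟨2 * X, by linarith, fun θ hθ => ?_⟩
  by_contra! hpos
  have := hθ.le_pohozaev hl hn hpos hcrit hX1 (by linarith)
  have := hθ.pohozaev_le hl hn hpos hm1 hnm (by linarith) le_rfl
  linarith

/-! ### Uniqueness and the obstruction at a zero. -/

/-- Only one argument has to avoid zero: if `b < δ / 2`, then `|a - b| ≥ δ / 2` while the powers
differ by at most `1`. Hence the competing solution needs no lower bound. -/
theorem exists_abs_rpow_sub_rpow_le {n δ : ℝ} (hn : 0 ≤ n) (hδ : 0 < δ) :
    ∃ L, 0 ≤ L ∧ ∀ a ∈ Icc δ 1, ∀ b ∈ Icc (0 : ℝ) 1, |a ^ n - b ^ n| ≤ L * |a - b| := by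
  have hd : ∀ x ∈ Icc (δ / 2) 1, HasDerivWithinAt (fun x : ℝ => x ^ n) (n * x ^ (n - 1))
      (Icc (δ / 2) 1) x := fun x hx =>
    (Real.hasDerivAt_rpow_const (Or.inl (by linarith [hx.1] : 0 < x).ne')).hasDerivWithinAt
  obtain ⟨M, hM⟩ := (isCompact_Icc (a := δ / 2) (b := (1 : ℝ))).exists_bound_of_continuousOn
    (f := fun x => n * x ^ (n - 1)) (continuousOn_const.mul
      (continuousOn_id.rpow_const fun x hx => Or.inl (by linarith [hx.1] : 0 < x).ne'))
  refine ⟨max M (2 / δ), le_max_of_le_right (by positivity), fun a ha b hb => ?_⟩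
  rcases le_or_gt (δ / 2) b with h | h
  · have := (convex_Icc (δ / 2) 1).norm_image_sub_le_of_norm_hasDerivWithin_le hd hM
      ⟨h, hb.2⟩ ⟨by linarith [ha.1], ha.2⟩
    exact this.trans (mul_le_mul_of_nonneg_right (le_max_left _ _) (abs_nonneg _))
  · have ha0 : 0 ≤ a := by linarith [ha.1]
    have h1 : |a ^ n - b ^ n| ≤ 1 := by
      rw [abs_le]
      constructor <;> linarith [Real.rpow_nonneg ha0 n, Real.rpow_le_one ha0 ha.2 hn,
        Real.rpow_nonneg hb.1 n, Real.rpow_le_one hb.1 hb.2 hn]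
    have h2 : δ / 2 ≤ |a - b| := le_trans (by linarith [ha.1]) (le_abs_self _)
    calc |a ^ n - b ^ n| ≤ 2 / δ * (δ / 2) := by field_simp; exact h1
      _ ≤ max M (2 / δ) * |a - b| :=
        mul_le_mul (le_max_right _ _) h2 (by positivity)
          (le_max_of_le_right (by positivity))

namespace IsLaneEmdenSolution

variable {l n r R : ℝ} {θ ψ : ℝ → ℝ}

/-- Grönwall for the squared distance in position and velocity. The singular term `(l - 1) / s` acts
as friction and has the favourable sign; the rest is absorbed by the rate `1 + L`. -/
theorem eqOn_of_le (hθ : IsLaneEmdenSolution l n r θ) (hψ : IsLaneEmdenSolution l n r ψ)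
    (hl : 2 ≤ l) (hn : 0 ≤ n) {δ : ℝ} (hδ : 0 < δ) (hle : ∀ s ∈ Icc 0 r, δ ≤ θ s) :
    EqOn ψ θ (Icc 0 r) := by
  obtain ⟨L, hL0, hL⟩ := exists_abs_rpow_sub_rpow_le hn hδ
  set y := derivWithin θ (Icc 0 r) with hy
  set z := derivWithin ψ (Icc 0 r) with hz
  have hyc : ContinuousOn y (Icc 0 r) := hθ.continuousOn_deriv hl hn
  have hzc : ContinuousOn z (Icc 0 r) := hψ.continuousOn_deriv hl hn
  have hec : Continuous fun s : ℝ => Real.exp (-(1 + L) * s) := by fun_prop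
  have hanti : AntitoneOn
      (fun s => ((θ s - ψ s) ^ 2 + (y s - z s) ^ 2) * Real.exp (-(1 + L) * s)) (Icc 0 r) := by
    refine antitoneOn_of_hasDerivWithinAt_nonpos (convex_Icc 0 r)
      (f' := fun s => (2 * (θ s - ψ s) * (y s - z s) + 2 * (y s - z s) *
        (-((l - 1) / s * (y s - z s)) - (θ s ^ n - ψ s ^ n)) -
        (1 + L) * ((θ s - ψ s) ^ 2 + (y s - z s) ^ 2)) * Real.exp (-(1 + L) * s))
      ((((hθ.continuousOn.sub hψ.continuousOn).pow 2).add ((hyc.sub hzc).pow 2)).mul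
        hec.continuousOn) (fun s hs => ?_) fun s hs => ?_
    · rw [interior_Icc] at hs ⊢
      have hs1 := Ioo_subset_Ioc_self hs
      have hsub := Ioo_subset_Icc_self (a := (0 : ℝ)) (b := r)
      have h1 := (((hθ.hasDerivWithinAt (hsub hs)).sub (hψ.hasDerivWithinAt (hsub hs))).pow 2).add
        (((hθ.hasDerivWithinAt_deriv hs1).sub (hψ.hasDerivWithinAt_deriv hs1)).pow 2)
      have h2 := (((hasDerivAt_id s).const_mul (-(1 + L))).exp).hasDerivWithinAt (s := Icc 0 r)
      refine ((h1.mul h2).mono hsub).congr_deriv ?_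
      simp only [Pi.add_apply, Pi.sub_apply, Pi.pow_apply, ← hy, ← hz, id]
      push_cast
      ring
    · have hs' := interior_subset hs
      rw [interior_Icc] at hs
      refine mul_nonpos_of_nonpos_of_nonneg ?_ (Real.exp_pos _).le
      have h1 := hL (θ s) ⟨hle s hs', hθ.le_one hl hs'⟩ (ψ s)
        ⟨hψ.nonneg s hs', hψ.le_one hl hs'⟩
      have h2 : 0 ≤ (l - 1) / s * (y s - z s) ^ 2 :=
        mul_nonneg (div_nonneg (by linarith) hs.1.le) (sq_nonneg _)
      have h3 : -(y s - z s) * (θ s ^ n - ψ s ^ n) ≤ |y s - z s| * (L * |θ s - ψ s|) := by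
        refine (le_abs_self _).trans ?_
        rw [abs_mul, abs_neg]
        exact mul_le_mul_of_nonneg_left h1 (abs_nonneg _)
      have h4 : 0 ≤ L * (|y s - z s| - |θ s - ψ s|) ^ 2 := mul_nonneg hL0 (sq_nonneg _)
      have h5 : 0 ≤ ((θ s - ψ s) - (y s - z s)) ^ 2 := sq_nonneg _
      rw [sub_sq, sq_abs, sq_abs] at h4
      linarith
  intro s hs
  have h1 := hanti ⟨le_rfl, hs.1.trans hs.2⟩ hs hs.1
  simp only [hθ.init, hψ.init, hy, hz, hθ.init_deriv, hψ.init_deriv] at h1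
  norm_num at h1
  have h2 : (θ s - ψ s) ^ 2 + (y s - z s) ^ 2 ≤ 0 :=
    nonpos_of_mul_nonpos_left h1 (Real.exp_pos _)
  have h3 : (θ s - ψ s) ^ 2 = 0 := le_antisymm (by linarith [sq_nonneg (y s - z s)]) (sq_nonneg _)
  exact (sub_eq_zero.1 (pow_eq_zero_iff two_ne_zero |>.1 h3)).symm

theorem eqOn_of_pos (hθ : IsLaneEmdenSolution l n r θ) (hψ : IsLaneEmdenSolution l n r ψ)
    (hr : 0 < r) (hl : 2 ≤ l) (hn : 0 ≤ n) (hpos : ∀ s ∈ Ico 0 r, 0 < θ s) :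
    EqOn ψ θ (Icc 0 r) := by
  have h : EqOn ψ θ (Ioo 0 r) := fun s hs => by
    have h1 := (hθ.restrict hs.1 hs.2.le).2
    exact h1.eqOn_of_le (hψ.restrict hs.1 hs.2.le).2 hl hn (hpos s ⟨hs.1.le, hs.2⟩)
      (fun t ht => h1.antitoneOn hl ht ⟨hs.1.le, le_rfl⟩ ht.2) ⟨hs.1.le, le_rfl⟩
  exact h.of_subset_closure hψ.continuousOn hθ.continuousOn Ioo_subset_Icc_self
    (closure_Ioo hr.ne).ge

/-- Once negative, the antitone flux stays negative, even where `θ` itself vanishes. -/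
theorem deriv_neg (h : IsLaneEmdenSolution l n R θ) (hl : 2 ≤ l) (hn : 0 ≤ n) {s ξ : ℝ}
    (hs : 0 < s) (hsξ : s ≤ ξ) (hξ : ξ ≤ R) (hpos : 0 < θ s) :
    derivWithin θ (Icc 0 R) ξ < 0 := by
  have hξ0 := hs.trans_le hsξ
  have h1 : derivWithin θ (Icc 0 R) s < 0 :=
    (h.deriv_le_neg_rpow_mul hl hn ⟨hs.le, hsξ.trans hξ⟩).trans_lt
      (neg_neg_of_pos (div_pos (mul_pos (Real.rpow_pos_of_pos hpos n) hs) (by linarith)))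
  have h2 := h.antitoneOn_flux ⟨hs, hsξ.trans hξ⟩ ⟨hξ0, hξ⟩ hsξ
  exact neg_of_mul_neg_right
    (h2.trans_lt (mul_neg_of_pos_of_neg (Real.rpow_pos_of_pos hs (l - 1)) h1))
    (Real.rpow_nonneg hξ0.le _)

/-- A solution cannot be continued past a zero. -/
theorem le_of_eq_zero (h : IsLaneEmdenSolution l n R ψ) (hl : 2 ≤ l) (hn : 0 ≤ n) {s ξ : ℝ}
    (hs : 0 < s) (hsξ : s ≤ ξ) (hpos : 0 < ψ s) (hξ : ψ ξ = 0) : R ≤ ξ := by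
  by_contra! hlt
  have hmem : ξ ∈ Ioo 0 R := ⟨hs.trans_le hsξ, hlt⟩
  -- An interior zero of a non-negative function is a minimum, so the slope there would be zero.
  have hmin : IsLocalMin ψ ξ := by
    filter_upwards [Icc_mem_nhds hmem.1 hmem.2] with t ht
    rw [hξ]
    exact h.nonneg t ht
  exact (h.deriv_neg hl hn hs hsξ hlt.le hpos).ne (hmin.hasDerivAt_eq_zero (h.hasDerivAt hmem))

end IsLaneEmdenSolution

/-! ### From the integral equation to the theorem. -/

theorem rpow_mul_radialFlux {l t : ℝ} {v : ℝ → ℝ} (ht : 0 ≤ t) :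
    t ^ (l - 1) * radialFlux (fun σ => σ ^ (l - 1)) v t =
      ∫ s in (0 : ℝ)..t, s ^ (l - 1) * v s := by
  have h := intervalIntegral.mul_integral_comp_mul_left (a := 0) (b := 1)
    (f := fun s => s ^ (l - 1) * v s) (c := t)
  rw [mul_zero, mul_one] at h
  rw [← h, radialFlux, ← intervalIntegral.integral_const_mul,
    ← intervalIntegral.integral_const_mul]
  refine intervalIntegral.integral_congr fun σ hσ => ?_
  rw [uIcc_of_le zero_le_one] at hσ
  simp only [Real.mul_rpow ht hσ.1]
  ring

/-- Non-negative solutions of the integral equation solve the Lane-Emden equation. -/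
theorem isLaneEmdenSolution_of_integral_eq {l n r : ℝ} {θ v : ℝ → ℝ} (hl : 2 ≤ l) (hr : 0 < r)
    (hv : Continuous v) (hθ0 : ∀ ξ ∈ Icc 0 r, 0 ≤ θ ξ)
    (hvθ : ∀ ξ ∈ Icc 0 r, v ξ = θ ξ ^ n)
    (heq : ∀ ξ ∈ Icc 0 r, θ ξ = 1 - radialPotential (fun σ => σ ^ (l - 1)) v ξ) :
    IsLaneEmdenSolution l n r θ := by
  have hw : Continuous fun σ : ℝ => σ ^ (l - 1) := Real.continuous_rpow_const (by linarith)
  have hd : ∀ ξ ∈ Icc 0 r, HasDerivWithinAt θ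
      (-radialFlux (fun σ => σ ^ (l - 1)) v ξ) (Icc 0 r) ξ := fun ξ hξ =>
    (((hasDerivAt_radialPotential hw hv ξ).const_sub 1).hasDerivWithinAt).congr heq (heq ξ hξ)
  have hd' : ∀ ξ ∈ Icc 0 r, derivWithin θ (Icc 0 r) ξ =
      -radialFlux (fun σ => σ ^ (l - 1)) v ξ := fun ξ hξ =>
    (hd ξ hξ).derivWithin (uniqueDiffOn_Icc hr ξ hξ)
  have hfl : ∀ ξ ∈ Icc 0 r, ξ ^ (l - 1) * derivWithin θ (Icc 0 r) ξ =
      -∫ s in (0 : ℝ)..ξ, s ^ (l - 1) * v s := fun ξ hξ => by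
    rw [hd' ξ hξ, mul_neg, rpow_mul_radialFlux hξ.1]
  have hfd : ∀ ξ ∈ Icc 0 r, HasDerivWithinAt
      (fun s => s ^ (l - 1) * derivWithin θ (Icc 0 r) s) (-(ξ ^ (l - 1) * v ξ)) (Icc 0 r) ξ :=
    fun ξ hξ => by
      have hc : Continuous fun s => s ^ (l - 1) * v s := hw.mul hv
      exact ((hc.integral_hasStrictDerivAt 0 ξ).hasDerivAt.neg.hasDerivWithinAt).congr hfl
        (hfl ξ hξ)
  refine ⟨hθ0, ?_, fun ξ hξ => (hd ξ hξ).differentiableWithinAt, ?_,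
    fun ξ hξ => (hfd ξ (Ioc_subset_Icc_self hξ)).differentiableWithinAt, fun ξ hξ => ?_⟩
  · simp [heq 0 ⟨le_rfl, hr.le⟩, radialPotential]
  · simp [hd' 0 ⟨le_rfl, hr.le⟩, radialFlux]
  · have hξ' := Ioc_subset_Icc_self hξ
    rw [(hfd ξ hξ').derivWithin (uniqueDiffOn_Icc hr ξ hξ'), hvθ ξ hξ']
    have := (Real.rpow_pos_of_pos hξ.1 (l - 1)).ne'
    field_simp
    ring

/-- Up to any `T` there is a continuous function which solves the Lane-Emden equation on every
interval on which it is non-negative. -/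
theorem exists_solution_while_nonneg {l n T : ℝ} (hl : 2 ≤ l) (hn : 0 ≤ n) (hT : 0 ≤ T) :
    ∃ θ : ℝ → ℝ, Continuous θ ∧ θ 0 = 1 ∧ ∀ r, 0 < r → r ≤ T → (∀ s ∈ Icc 0 r, 0 ≤ θ s) →
      IsLaneEmdenSolution l n r θ := by
  have hw : Continuous fun σ : ℝ => σ ^ (l - 1) := Real.continuous_rpow_const (by linarith)
  have hw0 : ∀ σ ∈ Icc (0 : ℝ) 1, 0 ≤ σ ^ (l - 1) := fun σ hσ => Real.rpow_nonneg hσ.1 _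
  have hw1 : ∀ σ ∈ Icc (0 : ℝ) 1, |σ ^ (l - 1)| ≤ 1 := fun σ hσ => by
    rw [abs_of_nonneg (hw0 σ hσ)]
    exact Real.rpow_le_one hσ.1 hσ.2 (by linarith)
  -- The upper cut-off is never active, because `g ≥ 0` forces `θ ≤ 1`; the lower one is inactive
  -- while `θ ≥ 0`.
  let g : ℝ → ℝ := fun u => max 0 (min u 1) ^ n
  have hg : Continuous g :=
    (Real.continuous_rpow_const hn).comp (continuous_const.max (continuous_id.min continuous_const))
  have hg0 : ∀ u, 0 ≤ g u := fun u => Real.rpow_nonneg (le_max_left _ _) _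
  have hg1 : ∀ u, |g u| ≤ 1 := fun u => by
    rw [abs_of_nonneg (hg0 u)]
    exact Real.rpow_le_one (le_max_left _ _) (max_le zero_le_one (min_le_right _ _)) hn
  obtain ⟨θ, hθ, heq⟩ := exists_radial_solution hg hg1 hw hw1 hT
  refine ⟨θ, hθ, by simp [heq 0 ⟨le_rfl, hT⟩, radialPotential], fun r hr hrT h0 => ?_⟩
  have heq' : ∀ ξ ∈ Icc 0 r, θ ξ = 1 - radialPotential (fun σ => σ ^ (l - 1))
      (fun s => g (θ s)) ξ := fun ξ hξ => heq ξ ⟨hξ.1, hξ.2.trans hrT⟩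
  refine isLaneEmdenSolution_of_integral_eq hl hr (hg.comp hθ) h0 (fun ξ hξ => ?_) heq'
  have h1 : θ ξ ≤ 1 := by
    rw [heq' ξ hξ]
    exact sub_le_self _ (radialPotential_nonneg hξ.1 hw0 fun s => hg0 _)
  simp only [Function.comp, g]
  rw [min_eq_left h1, max_eq_right (h0 ξ hξ)]

theorem mainTheorem1 (l n : ℝ) (hl : 2 ≤ l) (hn0 : 0 ≤ n) (hn5 : n < 5)
    (hsub : 3 < l → n < (l + 2) / (l - 2)) :
    ∃ (ξ₀ : ℝ) (θ : ℝ → ℝ), 0 < ξ₀ ∧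
      IsLaneEmdenSolution l n ξ₀ θ ∧
      (∀ ξ ∈ Set.Ico 0 ξ₀, 0 < θ ξ) ∧
      θ ξ₀ = 0 ∧
      ∀ (R : ℝ) (ψ : ℝ → ℝ), 0 < R → IsLaneEmdenSolution l n R ψ →
        R ≤ ξ₀ ∧ Set.EqOn ψ θ (Set.Icc 0 R) := by
  obtain ⟨T, hT, hbound⟩ := exists_bound_of_positive_solution hl hn0
    (mul_sub_two_lt_of_subcritical hl hn5 hsub)
  obtain ⟨θ, hθ, hinit, hsol⟩ := exists_solution_while_nonneg hl hn0 hT.le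
  have hne : (Icc 0 T ∩ {s | θ s ≤ 0}).Nonempty := by
    by_contra hempty
    rw [not_nonempty_iff_eq_empty, eq_empty_iff_forall_notMem] at hempty
    have hpos : ∀ s ∈ Icc 0 T, 0 < θ s := fun s hs => not_le.1 fun h => hempty s ⟨hs, h⟩
    obtain ⟨s, hs, hs0⟩ := hbound θ (hsol T hT le_rfl fun s hs => (hpos s hs).le)
    exact (hpos s hs).not_ge hs0
  have hcomp : IsCompact (Icc 0 T ∩ {s | θ s ≤ 0}) :=
    isCompact_Icc.inter_right (isClosed_le hθ continuous_const)
  obtain ⟨ξ₀, ⟨hmem, hle⟩, hleast⟩ := hcomp.exists_isLeast hne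
  have hξ0 : 0 < ξ₀ := hmem.1.lt_of_ne fun h => by
    have h1 : θ ξ₀ ≤ 0 := hle
    rw [← h, hinit] at h1
    exact not_le.2 one_pos h1
  have hpos : ∀ ξ ∈ Ico 0 ξ₀, 0 < θ ξ := fun ξ hξ => not_le.1 fun h =>
    hξ.2.not_ge (hleast ⟨⟨hξ.1, hξ.2.le.trans hmem.2⟩, h⟩)
  have hzero : θ ξ₀ = 0 := by
    refine le_antisymm hle (closure_minimal (fun ξ hξ => (hpos ξ hξ).le)
      (isClosed_le continuous_const hθ) ?_)
    rw [closure_Ico hξ0.ne]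
    exact ⟨hξ0.le, le_rfl⟩
  have hnonneg : ∀ s ∈ Icc 0 ξ₀, 0 ≤ θ s := fun s hs => by
    rcases hs.2.eq_or_lt with h | h
    · rw [h, hzero]
    · exact (hpos s ⟨hs.1, h⟩).le
  have hsol0 := hsol ξ₀ hξ0 hmem.2 hnonneg
  refine ⟨ξ₀, θ, hξ0, hsol0, hpos, hzero, fun R ψ hR hψ => ?_⟩
  have hRle : R ≤ ξ₀ := by
    -- Otherwise `ψ` would agree with `θ` up to `ξ₀` and vanish at an interior point of its
    -- interval.
    by_contra! hlt
    have heq := hsol0.eqOn_of_pos (hψ.restrict hξ0 hlt.le).2 hξ0 hl hn0 hpos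
    refine hlt.not_ge (hψ.le_of_eq_zero hl hn0 (half_pos hξ0) (by linarith) ?_ ?_)
    · rw [heq ⟨by linarith, by linarith⟩]
      exact hpos _ ⟨by linarith, by linarith⟩
    · rw [heq ⟨hξ0.le, le_rfl⟩, hzero]
  exact ⟨hRle, (hsol0.restrict hR hRle).2.eqOn_of_pos hψ hR hl hn0 fun s hs =>
    hpos s ⟨hs.1, hs.2.trans_le hRle⟩⟩
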